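/- Let $(\mathcal{C},\mathbb{E},\mathfrak{s})$ be an extriangulated category in the sense of Nakaoka and Palu, and let $\mathcal{M}$ be a full additive subcategory of $\mathcal{C}$ (that is, closed under finite direct sums). Notation. If $A\xrightarrow{x}B\xrightarrow{y}C$ realizes some $\delta\in\mathbb{E}(C,A)$, then $x$ is called an $\mathfrak{s}$-inflation and $y$ an $\mathfrak{s}$-deflation. An object $P$ is projective if every morphism $P\to C$ factors through every $\mathfrak{s}$-deflation $B\to C$; $\mathcal{P}$ is the class of projectives, and $\mathcal{C}$ has enough projectives if every object $C$ admits an $\mathfrak{s}$-deflation $P\to C$ with $P\in\mathcal{P}$. Injective objects, the class $\mathcal{I}$ of injectives, and having enough injectives are defined dually, with $\mathfrak{s}$-inflations. $\mathrm{Mor}(\mathcal{M})$ is the category of morphisms of $\mathcal{M}$ and commutative squares; $\mathfrak{s}\text{-def}(\mathcal{M})$ (resp. $\mathfrak{s}\text{-inf}(\mathcal{M})$) is its full subcategory of those morphisms $M_1\to M_2$ of $\mathcal{M}$ that are $\mathfrak{s}$-deflations (resp. $\mathfrak{s}$-inflations) in $\mathcal{C}$. Further, - $\text{s-epi}(\mathcal{M})\subseteq\mathfrak{s}\text{-def}(\mathcal{M})$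 consists of the split epimorphisms, and $\text{s-mono}(\mathcal{M})\subseteq\mathfrak{s}\text{-inf}(\mathcal{M})$ of the split monomorphisms; - $\text{sp-epi}(\mathcal{M})\subseteq\mathfrak{s}\text{-def}(\mathcal{M})$ consists of the objects isomorphic to $(M\xrightarrow{1}M)\oplus(P\to M')$ with $M,M'\in\mathcal{M}$ and $P\in\mathcal{P}$; - $\text{si-mono}(\mathcal{M})\subseteq\mathfrak{s}\text{-inf}(\mathcal{M})$ consists of the objects isomorphic to $(M\xrightarrow{1}M)\oplus(M'\to I)$ with $M,M'\in\mathcal{M}$ and $I\in\mathcal{I}$. For a class $\mathcal{B}$ of objects of an additive category $\mathcal{A}$, $[\mathcal{B}]$ is the ideal generated by the morphisms that factor through an object of $\mathcal{B}$, and $\mathcal{A}/[\mathcal{B}]$ is the quotient category. For an additive category $\mathcal{D}$, $\text{mod-}\mathcal{D}$ is the category of finitely presented right $\mathcal{D}$-modules, i.e. of the additive functors $F:\mathcal{D}^{\mathrm{op}}\to \mathrm{Ab}$ that admit an exact sequence $\mathcal{D}(-,X)\to\mathcal{D}(-,Y)\to F\to 0$ with $X,Y\in\mathcal{D}$. The symbol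 $\simeq$ denotes equivalence of categories. (1) If $\mathcal{C}$ has enough projectives and $\mathcal{P}\subseteq\mathcal{M}$, then $$\mathfrak{s}\text{-def}(\mathcal{M})/[\text{s-epi}(\mathcal{M})]\simeq\text{mod-}(\mathcal{M}/[\mathcal{P}]),\qquad \mathfrak{s}\text{-def}(\mathcal{M})/[\text{sp-epi}(\mathcal{M})]\simeq\bigl(\text{mod-}(\mathcal{M}/[\mathcal{P}])^{\mathrm{op}}\bigr)^{\mathrm{op}}.$$ (2) If $\mathcal{C}$ has enough injectives and $\mathcal{I}\subseteq\mathcal{M}$, then $$\mathfrak{s}\text{-inf}(\mathcal{M})/[\text{s-mono}(\mathcal{M})]\simeq\bigl(\text{mod-}(\mathcal{M}/[\mathcal{I}])^{\mathrm{op}}\bigr)^{\mathrm{op}},\qquad \mathfrak{s}\text{-inf}(\mathcal{M})/[\text{si-mono}(\mathcal{M})]\simeq\text{mod-}(\mathcal{M}/[\mathcal{I}]).$$ -/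

import Mathlib

open CategoryTheory CategoryTheory.Limits Opposite

universe w v u

namespace Extri

section Ideals

variable {D : Type u} [Category.{v} D] [Preadditive D]

/-- The ideal `[B]` of a preadditive category generated by a class `B` of objects: `[B](X, Y)` is
the subgroup of `X ⟶ Y` generated by the morphisms which factor through an object of `B`. If `B` is
closed under finite direct sums this is just the set of morphisms which factor through an object of
`B`, see `mem_idealOf_iff`. -/
def idealOf (B : ObjectProperty D) (X Y : D) : AddSubgroup (X ⟶ Y) :=
  AddSubgroup.closure {f | ∃ (Z : D) (g : X ⟶ Z) (h : Z ⟶ Y), B Z ∧ g ≫ h = f}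

lemma mem_idealOf_iff (B : ObjectProperty D) (h0 : ∃ Z, B Z)
    (hB : ∀ Z W, B Z → B W → ∃ b : BinaryBicone Z W, B b.pt) {X Y : D} (f : X ⟶ Y) :
    f ∈ idealOf B X Y ↔ ∃ (Z : D) (g : X ⟶ Z) (h : Z ⟶ Y), B Z ∧ g ≫ h = f := by
  refine ⟨fun hf => ?_, fun hf => AddSubgroup.subset_closure hf⟩
  induction hf using AddSubgroup.closure_induction with
  | mem x hx => exact hx
  | zero =>
    obtain ⟨Z, hZ⟩ := h0
    exact ⟨Z, 0, 0, hZ, by simp⟩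
  | add x y _ _ hx hy =>
    obtain ⟨Z, g, h, hZ, rfl⟩ := hx
    obtain ⟨W, g', h', hW, rfl⟩ := hy
    obtain ⟨b, hb⟩ := hB Z W hZ hW
    exact ⟨b.pt, g ≫ b.inl + g' ≫ b.inr, b.fst ≫ h + b.snd ≫ h', hb, by simp⟩
  | neg x _ hx =>
    obtain ⟨Z, g, h, hZ, rfl⟩ := hx
    exact ⟨Z, -g, h, hZ, by simp⟩

lemma comp_mem_idealOf (B : ObjectProperty D) {X Y Z : D} (f : X ⟶ Y) {g : Y ⟶ Z}
    (hg : g ∈ idealOf B Y Z) : f ≫ g ∈ idealOf B X Z := by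
  induction hg using AddSubgroup.closure_induction with
  | mem x hx =>
    obtain ⟨W, a, b, hW, rfl⟩ := hx
    exact AddSubgroup.subset_closure ⟨W, f ≫ a, b, hW, by simp⟩
  | zero => simp
  | add x y _ _ hx hy => rw [Preadditive.comp_add]; exact add_mem hx hy
  | neg x _ hx => rw [Preadditive.comp_neg]; exact neg_mem hx

lemma mem_idealOf_comp (B : ObjectProperty D) {X Y Z : D} {f : X ⟶ Y} (g : Y ⟶ Z)
    (hf : f ∈ idealOf B X Y) : f ≫ g ∈ idealOf B X Z := by
  induction hf using AddSubgroup.closure_induction with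
  | mem x hx =>
    obtain ⟨W, a, b, hW, rfl⟩ := hx
    exact AddSubgroup.subset_closure ⟨W, a, b ≫ g, hW, by simp⟩
  | zero => simp
  | add x y _ _ hx hy => rw [Preadditive.add_comp]; exact add_mem hx hy
  | neg x _ hx => rw [Preadditive.neg_comp]; exact neg_mem hx

/-- Two parallel morphisms are identified when their difference lies in `[B]`. -/
def idealRel (B : ObjectProperty D) : HomRel D := fun X Y f g => f - g ∈ idealOf B X Y

instance idealRel_congruence (B : ObjectProperty D) : Congruence (idealRel B) where
  comp_left f g g' h := by
    simpa [idealRel, Preadditive.comp_sub] using comp_mem_idealOf B f h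
  comp_right g h := by
    simpa [idealRel, Preadditive.sub_comp] using mem_idealOf_comp B g h
  equivalence :=
    { refl := fun f => by simp [idealRel]
      symm := fun {f g} h => by simpa [idealRel] using neg_mem h
      trans := fun {f g k} h h' => by simpa [idealRel] using add_mem h h' }

/-- The ideal quotient category `D/[B]`. -/
abbrev IdealQuotient (B : ObjectProperty D) : Type u := CategoryTheory.Quotient (idealRel B)

instance idealQuotientPreadditive (B : ObjectProperty D) : Preadditive (IdealQuotient B) :=
  CategoryTheory.Quotient.preadditive (idealRel B) fun X Y f₁ f₂ g₁ g₂ h h' => by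
    have := add_mem h h'
    rwa [sub_add_sub_comm] at this

/-- A contravariant functor `F` from `D` to abelian groups is a finitely presented right
`D`-module: it is additive and there is an exact sequence `D(-, X) → D(-, Y) → F → 0`. -/
def IsFinPresModule (D : Type u) [Category.{v} D] [Preadditive D] :
    ObjectProperty (Dᵒᵖ ⥤ AddCommGrpCat.{v}) := fun F =>
  F.Additive ∧ ∃ (X Y : D) (α : preadditiveYoneda.obj X ⟶ preadditiveYoneda.obj Y)
    (π : preadditiveYoneda.obj Y ⟶ F),
    ∀ Z : Dᵒᵖ, Function.Exact (α.app Z) (π.app Z) ∧ Function.Surjective (π.app Z)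

/-- `mod-D`, the category of finitely presented right `D`-modules. -/
abbrev FinPresMod (D : Type u) [Category.{v} D] [Preadditive D] : Type (max u (v + 1)) :=
  (IsFinPresModule D).FullSubcategory

end Ideals

section Sequences

variable {C : Type u} [Category.{v} C]

/-- A sequence `A ⟶ B ⟶ C₀` with prescribed end terms. -/
structure Seq (A C₀ : C) where
  mid : C
  fst : A ⟶ mid
  snd : mid ⟶ C₀

/-- Equivalence of sequences: an isomorphism of middle terms which is the identity on the ends. -/
def seqSetoid (A C₀ : C) : Setoid (Seq A C₀) where
  r S T := ∃ b : S.mid ≅ T.mid, S.fst ≫ b.hom = T.fst ∧ b.hom ≫ T.snd = S.snd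
  iseqv :=
    { refl := fun S => ⟨Iso.refl _, by simp, by simp⟩
      symm := fun {S T} ⟨b, h₁, h₂⟩ => ⟨b.symm, by simp [← h₁], by simp [← h₂]⟩
      trans := fun {S T U} ⟨b, h₁, h₂⟩ ⟨c, h₃, h₄⟩ =>
        ⟨b ≪≫ c, by simp [reassoc_of% h₁, h₃], by simp [h₄, h₂]⟩ }

/-- Equivalence classes `[A ⟶ B ⟶ C₀]`. -/
abbrev SeqClass (A C₀ : C) : Type (max u v) := _root_.Quotient (seqSetoid A C₀)

/-- The class `[A --x--> B --y--> C₀]`. -/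
def seqClass {A B C₀ : C} (x : A ⟶ B) (y : B ⟶ C₀) : SeqClass A C₀ :=
  _root_.Quotient.mk (seqSetoid A C₀) ⟨B, x, y⟩

end Sequences

section Extensions

variable {C : Type u} [Category.{v} C] (E : Cᵒᵖ ⥤ C ⥤ AddCommGrpCat.{w})

/-- The abelian group `𝔼(C₀, A)` of extensions. -/
abbrev Ext (C₀ A : C) : Type w := (E.obj (op C₀)).obj A

/-- `a_* δ`. -/
def push {C₀ A A' : C} (a : A ⟶ A') (δ : Ext E C₀ A) : Ext E C₀ A' :=
  (E.obj (op C₀)).map a δ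

/-- `c^* δ`. -/
def pull {C₀ C₁ A : C} (c : C₁ ⟶ C₀) (δ : Ext E C₀ A) : Ext E C₁ A :=
  (E.map c.op).app A δ

/-- `δ ⊕ δ'`, the extension of `C₀ ⊕ C₁` by `A ⊕ A'` with components `(δ, 0, 0, δ')`. -/
noncomputable def extSum [Preadditive C] [HasBinaryBiproducts C] {C₀ A C₁ A' : C}
    (δ : Ext E C₀ A) (δ' : Ext E C₁ A') : Ext E (C₀ ⊞ C₁) (A ⊞ A') :=
  push E biprod.inl (pull E biprod.fst δ) + push E biprod.inr (pull E biprod.snd δ')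

end Extensions

/-- An extriangulated structure `(𝔼, 𝔰)` on an additive category `C`. -/
structure ExtriangulatedStructure (C : Type u) [Category.{v} C] [Preadditive C]
    [HasZeroObject C] [HasBinaryBiproducts C] where
  /-- The bifunctor `𝔼 : Cᵒᵖ × C ⥤ Ab`, additive in both variables. -/
  E : Cᵒᵖ ⥤ C ⥤ AddCommGrpCat.{w}
  additive_left : E.Additive
  additive_right : ∀ X : Cᵒᵖ, (E.obj X).Additive
  /-- The realization `𝔰`. -/
  s : ∀ {C₀ A : C}, Ext E C₀ A → SeqClass A C₀
  /-- Every morphism of extensions is realized by a morphism of sequences. -/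
  realize : ∀ {A B C₀ A' B' C₀' : C} (δ : Ext E C₀ A) (δ' : Ext E C₀' A')
    (x : A ⟶ B) (y : B ⟶ C₀) (x' : A' ⟶ B') (y' : B' ⟶ C₀') (a : A ⟶ A') (c : C₀ ⟶ C₀'),
    s δ = seqClass x y → s δ' = seqClass x' y' → push E a δ = pull E c δ' →
    ∃ b : B ⟶ B', x ≫ b = a ≫ x' ∧ y ≫ c = b ≫ y'
  s_zero : ∀ A C₀ : C, s (0 : Ext E C₀ A) = seqClass (biprod.inl : A ⟶ A ⊞ C₀) biprod.snd
  s_sum : ∀ {A B C₀ A' B' C₀' : C} (δ : Ext E C₀ A) (δ' : Ext E C₀' A')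
    (x : A ⟶ B) (y : B ⟶ C₀) (x' : A' ⟶ B') (y' : B' ⟶ C₀'),
    s δ = seqClass x y → s δ' = seqClass x' y' →
    s (extSum E δ δ') = seqClass (biprod.map x x') (biprod.map y y')
  et3 : ∀ {A B C₀ A' B' C₀' : C} (δ : Ext E C₀ A) (δ' : Ext E C₀' A')
    (x : A ⟶ B) (y : B ⟶ C₀) (x' : A' ⟶ B') (y' : B' ⟶ C₀') (a : A ⟶ A') (b : B ⟶ B'),
    s δ = seqClass x y → s δ' = seqClass x' y' → x ≫ b = a ≫ x' →
    ∃ c : C₀ ⟶ C₀', y ≫ c = b ≫ y' ∧ push E a δ = pull E c δ'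
  et3_op : ∀ {A B C₀ A' B' C₀' : C} (δ : Ext E C₀ A) (δ' : Ext E C₀' A')
    (x : A ⟶ B) (y : B ⟶ C₀) (x' : A' ⟶ B') (y' : B' ⟶ C₀') (b : B ⟶ B') (c : C₀ ⟶ C₀'),
    s δ = seqClass x y → s δ' = seqClass x' y' → y ≫ c = b ≫ y' →
    ∃ a : A ⟶ A', x ≫ b = a ≫ x' ∧ push E a δ = pull E c δ'
  et4 : ∀ {A B C₀ D F : C} (f : A ⟶ B) (f' : B ⟶ D) (g : B ⟶ C₀) (g' : C₀ ⟶ F)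
    (δ : Ext E D A) (δ' : Ext E F B), s δ = seqClass f f' → s δ' = seqClass g g' →
    ∃ (E₀ : C) (h : A ⟶ C₀) (h' : C₀ ⟶ E₀) (d : D ⟶ E₀) (e : E₀ ⟶ F) (δ'' : Ext E E₀ A),
      f ≫ g = h ∧ f' ≫ d = g ≫ h' ∧ h' ≫ e = g' ∧
      s δ'' = seqClass h h' ∧ s (push E f' δ') = seqClass d e ∧
      pull E d δ'' = δ ∧ push E f δ'' = pull E e δ'
  et4_op : ∀ {A B C₀ D F : C} (f' : D ⟶ A) (f : A ⟶ B) (g' : F ⟶ B) (g : B ⟶ C₀)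
    (δ : Ext E B D) (δ' : Ext E C₀ F), s δ = seqClass f' f → s δ' = seqClass g' g →
    ∃ (E₀ : C) (d : D ⟶ E₀) (e : E₀ ⟶ F) (h' : E₀ ⟶ A) (h : A ⟶ C₀) (δ'' : Ext E C₀ E₀),
      d ≫ h' = f' ∧ e ≫ g' = h' ≫ f ∧ f ≫ g = h ∧
      s (pull E g' δ) = seqClass d e ∧ s δ'' = seqClass h' h ∧
      push E e δ'' = δ' ∧ push E d δ = pull E g δ''

namespace ExtriangulatedStructure

variable {C : Type u} [Category.{v} C] [Preadditive C] [HasZeroObject C] [HasBinaryBiproducts C]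
  (S : ExtriangulatedStructure.{w} C)

/-- `𝔰`-inflations. -/
def IsInflation {A B : C} (x : A ⟶ B) : Prop :=
  ∃ (C₀ : C) (y : B ⟶ C₀) (δ : Ext S.E C₀ A), S.s δ = seqClass x y

/-- `𝔰`-deflations. -/
def IsDeflation {B C₀ : C} (y : B ⟶ C₀) : Prop :=
  ∃ (A : C) (x : A ⟶ B) (δ : Ext S.E C₀ A), S.s δ = seqClass x y

/-- The class `𝒫` of projective objects. -/
def projectives : ObjectProperty C := fun P =>
  ∀ ⦃B C₀ : C⦄ (y : B ⟶ C₀), S.IsDeflation y → ∀ c : P ⟶ C₀, ∃ b : P ⟶ B, b ≫ y = c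

/-- The class `ℐ` of injective objects. -/
def injectives : ObjectProperty C := fun I =>
  ∀ ⦃A B : C⦄ (x : A ⟶ B), S.IsInflation x → ∀ a : A ⟶ I, ∃ b : B ⟶ I, x ≫ b = a

def HasEnoughProjectives : Prop :=
  ∀ C₀ : C, ∃ (P : C) (y : P ⟶ C₀), S.projectives P ∧ S.IsDeflation y

def HasEnoughInjectives : Prop :=
  ∀ A : C, ∃ (I : C) (x : A ⟶ I), S.injectives I ∧ S.IsInflation x

variable (M : ObjectProperty C)

/-- The objects of `Mor(M)` which are `𝔰`-deflations. -/
def deflations : ObjectProperty (Arrow M.FullSubcategory) := fun f => S.IsDeflation f.hom.hom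

/-- The objects of `Mor(M)` which are `𝔰`-inflations. -/
def inflations : ObjectProperty (Arrow M.FullSubcategory) := fun f => S.IsInflation f.hom.hom

/-- The category `𝔰-def(M)`, a full subcategory of `Mor(M)`. -/
abbrev SDef : Type (max u v) := (S.deflations M).FullSubcategory

/-- The category `𝔰-inf(M)`, a full subcategory of `Mor(M)`. -/
abbrev SInf : Type (max u v) := (S.inflations M).FullSubcategory

/-- `s-epi(M)`: the split epimorphisms in `𝔰-def(M)`. -/
def sEpi : ObjectProperty (S.SDef M) := fun f => IsSplitEpi f.obj.hom

/-- `s-mono(M)`: the split monomorphisms in `𝔰-inf(M)`. -/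
def sMono : ObjectProperty (S.SInf M) := fun f => IsSplitMono f.obj.hom

/-- `sp-epi(M)`: the objects of `𝔰-def(M)` of the form `(X --1--> X) ⊕ (P ⟶ Y)` with `X, Y` in `M`
and `P` projective. -/
def spEpi : ObjectProperty (S.SDef M) := fun f =>
  ∃ (X P Y : C) (p : P ⟶ Y), M X ∧ S.projectives P ∧ M Y ∧
    Nonempty (Arrow.mk f.obj.hom.hom ≅ Arrow.mk (biprod.map (𝟙 X) p))

/-- `si-mono(M)`: the objects of `𝔰-inf(M)` of the form `(X --1--> X) ⊕ (Y ⟶ I)` with `X, Y` in `M`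
and `I` injective. -/
def siMono : ObjectProperty (S.SInf M) := fun f =>
  ∃ (X Y I : C) (j : Y ⟶ I), M X ∧ M Y ∧ S.injectives I ∧
    Nonempty (Arrow.mk f.obj.hom.hom ≅ Arrow.mk (biprod.map (𝟙 X) j))

/-- The quotient category `M/[𝒫]`. -/
abbrev ModProjectives : Type u := IdealQuotient (S.projectives.inverseImage M.ι)

/-- The quotient category `M/[ℐ]`. -/
abbrev ModInjectives : Type u := IdealQuotient (S.injectives.inverseImage M.ι)

end ExtriangulatedStructure

end Extri

/-!
For a preadditive category `K`, sending a morphism `f : X ⟶ Y` to the module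
`Coker (K(-, X) ⟶ K(-, Y))` defines a functor from `Mor(K)` to `mod-K` (`presentedModule`). By the
Yoneda lemma it is full, it is essentially surjective by the definition of `mod-K`, and it kills a
square `(a, b) : f ⟶ g` exactly when `b` factors through `g` (`presentedModule_map_eq_iff`). Applied
to `Kᵒᵖ` this gives a functor from `Mor(K)` to `(mod-Kᵒᵖ)ᵒᵖ` (`presentedLeftModule`), which kills
`(a, b)` exactly when `a` factors through `f`.

All four equivalences arise by restricting one of these two functors, for `K = M/[𝒫]` or
`K = M/[ℐ]`, along `𝔰-def(M) ⥤ Mor(M/[𝒫])` or `𝔰-inf(M) ⥤ Mor(M/[ℐ])`. In the first case, this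
functor is full because a morphism `Q ⟶ Y` with `Q` projective lifts along deflations to `Y`, so
that a square which commutes up to `[𝒫]` can be corrected to a commutative one. It is essentially
surjective because, for a deflation `p : Q ⟶ Y` with `Q` projective, `(g, p) : X ⊕ Q ⟶ Y` is a
deflation for each `g : X ⟶ Y` (`IsDeflation.desc`), and is isomorphic to `g` in `M/[𝒫]`.

It remains to see that a square `(a, b) : f ⟶ g` is killed exactly when it lies in the ideal in
question. A diagonal `h` yields a square `(f h, h g)`, which factors through an identity morphism
(`diagonalSquare_mem`). Modulo such squares, there are two cases.

* For `s-epi(M)`, the morphism `b` may be taken to be zero, and then `(a, 0)` factors through the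
  split epimorphism from the source of `f` to `0` (`mem_idealOf_of_right_mem_of_lifting`).
* For `sp-epi(M)`, the morphism `a = u v` factors through a projective object `Q`. Let
  `p : Q' ⟶ Y` be a deflation from a projective object onto the target of `g`. Then `(a, b)` factors
  through the deflation `(v g, p) : Q ⊕ Q' ⟶ Y` (`mem_idealOf_of_left_eq_comp`).

The arguments for inflations are dual.
-/

open scoped ZeroObject

namespace Extri

/-! ### The module presented by a morphism -/

section Coker

variable {K : Type u} [Category.{v} K]

lemma cokernel_π_app_surjective {F G : Kᵒᵖ ⥤ AddCommGrpCat.{v}} (α : F ⟶ G) (Z : Kᵒᵖ) :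
    Function.Surjective ((cokernel.π α).app Z) := by
  have : Epi ((cokernel.π α).app Z) := inferInstance
  exact (AddCommGrpCat.epi_iff_surjective _).1 this

lemma cokernel_π_app_exact {F G : Kᵒᵖ ⥤ AddCommGrpCat.{v}} (α : F ⟶ G) (Z : Kᵒᵖ) :
    Function.Exact (α.app Z) ((cokernel.π α).app Z) := by
  have h := (ShortComplex.exact_cokernel α).map ((evaluation Kᵒᵖ AddCommGrpCat.{v}).obj Z)
  rw [ShortComplex.ab_exact_iff_function_exact] at h
  exact h

variable [Preadditive K]

lemma additive_of_surjective {F G : Kᵒᵖ ⥤ AddCommGrpCat.{v}} (π : G ⟶ F) [G.Additive]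
    (hπ : ∀ Z, Function.Surjective (π.app Z)) : F.Additive where
  map_add {X Y f g} := by
    ext x
    obtain ⟨y, rfl⟩ := hπ _ x
    have h := fun k : X ⟶ Y => (NatTrans.naturality_apply π k y).symm
    rw [h, Functor.map_add]
    exact (map_add (π.app Y).hom _ _).trans (congrArg₂ (· + ·) (h f).symm (h g).symm)

lemma isFinPresModule_cokernel {X Y : K} (f : X ⟶ Y) :
    IsFinPresModule K (cokernel (preadditiveYoneda.map f)) :=
  ⟨additive_of_surjective (cokernel.π (preadditiveYoneda.map f)) (cokernel_π_app_surjective _),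
    X, Y, preadditiveYoneda.map f, cokernel.π _,
    fun Z => ⟨cokernel_π_app_exact _ Z, cokernel_π_app_surjective _ Z⟩⟩

variable (K) in
/-- The functor sending a morphism `f : X ⟶ Y` of `K` to the finitely presented right module
`Coker (K(-, X) ⟶ K(-, Y))`. -/
noncomputable def presentedModule : Arrow K ⥤ FinPresMod K :=
  (IsFinPresModule K).lift (preadditiveYoneda.mapArrow ⋙ coker _)
    fun f => isFinPresModule_cokernel f.hom

lemma presentedModule_π {f g : Arrow K} (φ : f ⟶ g) :
    cokernel.π (preadditiveYoneda.map f.hom) ≫ ((presentedModule K).map φ).hom =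
      preadditiveYoneda.map φ.right ≫ cokernel.π (preadditiveYoneda.map g.hom) :=
  cokernel.π_desc _ _ _

lemma presentedModule_map_apply {f g : Arrow K} (φ : f ⟶ g) (Z : K) (y : Z ⟶ f.right) :
    ((presentedModule K).map φ).hom.app (op Z)
        ((cokernel.π (preadditiveYoneda.map f.hom)).app (op Z) y) =
      (cokernel.π (preadditiveYoneda.map g.hom)).app (op Z) (y ≫ φ.right) :=
  ConcreteCategory.congr_hom (NatTrans.congr_app (presentedModule_π φ) (op Z)) y

lemma cokernel_π_app_eq_zero_iff {X Y : K} (f : X ⟶ Y) {Z : K} (y : Z ⟶ Y) :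
    (cokernel.π (preadditiveYoneda.map f)).app (op Z) y = 0 ↔ ∃ h : Z ⟶ X, h ≫ f = y :=
  cokernel_π_app_exact (preadditiveYoneda.map f) (op Z) y

/-- Two morphisms of presentations induce the same map of presented modules exactly when their
difference on the right factors through the target presentation. -/
lemma presentedModule_map_eq_iff {f g : Arrow K} (φ ψ : f ⟶ g) :
    (presentedModule K).map φ = (presentedModule K).map ψ ↔
      ∃ h : f.right ⟶ g.left, φ.right - ψ.right = h ≫ g.hom := by
  have key : (∃ h : f.right ⟶ g.left, φ.right - ψ.right = h ≫ g.hom) ↔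
      (cokernel.π (preadditiveYoneda.map g.hom)).app (op f.right) φ.right =
        (cokernel.π (preadditiveYoneda.map g.hom)).app (op f.right) ψ.right := by
    refine Iff.trans (exists_congr fun _ => eq_comm)
      ((cokernel_π_app_eq_zero_iff g.hom (φ.right - ψ.right)).symm.trans ?_)
    exact (map_sub ((cokernel.π (preadditiveYoneda.map g.hom)).app (op f.right)).hom
      φ.right ψ.right).congr_left.trans sub_eq_zero
  rw [key]
  constructor
  · intro h
    have h1 := presentedModule_map_apply φ _ (𝟙 f.right)
    have h2 := presentedModule_map_apply ψ _ (𝟙 f.right)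
    rw [Category.id_comp] at h1 h2
    rw [← h1, ← h2, h]
  · intro h
    ext ⟨Z⟩ x
    obtain ⟨y, rfl⟩ := cokernel_π_app_surjective (preadditiveYoneda.map f.hom) (op Z) x
    have hn (χ : f.right ⟶ g.right) :
        (cokernel.π (preadditiveYoneda.map g.hom)).app (op Z) (y ≫ χ) =
          (coker (Kᵒᵖ ⥤ AddCommGrpCat.{v})|>.obj (Arrow.mk (preadditiveYoneda.map g.hom))).map
            y.op ((cokernel.π (preadditiveYoneda.map g.hom)).app (op f.right) χ) :=
      NatTrans.naturality_apply (cokernel.π (preadditiveYoneda.map g.hom)) y.op χ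
    exact (presentedModule_map_apply φ Z y).trans
      (((hn _).trans ((congrArg _ h).trans (hn _).symm)).trans
        (presentedModule_map_apply ψ Z y).symm)

instance : (presentedModule K).Full where
  map_surjective {f g} φ := by
    let πf := cokernel.π (preadditiveYoneda.map f.hom)
    let πg := cokernel.π (preadditiveYoneda.map g.hom)
    -- The representable functor `K(-, f.right)` is projective, by the Yoneda lemma.
    obtain ⟨b, hb⟩ := cokernel_π_app_surjective (preadditiveYoneda.map g.hom) (op f.right)
      (φ.hom.app (op f.right) (πf.app (op f.right) (𝟙 f.right)))
    have hφ (Z : K) (y : Z ⟶ f.right) :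
        φ.hom.app (op Z) (πf.app (op Z) y) =
          πg.app (op Z) (y ≫ (show f.right ⟶ g.right from b)) := by
      have h1 := NatTrans.naturality_apply (πf ≫ φ.hom) y.op (𝟙 f.right)
      have h2 := NatTrans.naturality_apply πg y.op b
      have h3 : (preadditiveYoneda.obj f.right).map y.op (𝟙 f.right) = y := Category.comp_id y
      rw [h3] at h1
      exact h1.trans ((congrArg _ hb.symm).trans h2.symm)
    have hz : πg.app (op f.left) (f.hom ≫ (show f.right ⟶ g.right from b)) = 0 := by
      rw [← hφ, (cokernel_π_app_eq_zero_iff f.hom f.hom).2 ⟨𝟙 _, by simp⟩]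
      exact map_zero (φ.hom.app (op f.left)).hom
    obtain ⟨a, ha⟩ := (cokernel_π_app_eq_zero_iff g.hom _).1 hz
    refine ⟨Arrow.homMk a b ha, ?_⟩
    ext ⟨Z⟩ x
    obtain ⟨y, rfl⟩ := cokernel_π_app_surjective (preadditiveYoneda.map f.hom) (op Z) x
    exact (presentedModule_map_apply _ Z y).trans (hφ Z y).symm

instance : (presentedModule K).EssSurj where
  mem_essImage F := by
    obtain ⟨X, Y, α, π, h⟩ := F.property.2
    obtain ⟨f, rfl⟩ := preadditiveYoneda.map_surjective α
    have hz : preadditiveYoneda.map f ≫ π = 0 := by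
      ext Z x
      exact (h Z).1.apply_apply_eq_zero x
    let d := cokernel.desc _ π hz
    have hd (Z : Kᵒᵖ) (y : (preadditiveYoneda.obj Y).obj Z) :
        d.app Z ((cokernel.π (preadditiveYoneda.map f)).app Z y) = π.app Z y :=
      ConcreteCategory.congr_hom (NatTrans.congr_app (cokernel.π_desc _ π hz) Z) y
    have : ∀ Z, IsIso (d.app Z) := fun Z => by
      rw [ConcreteCategory.isIso_iff_bijective]
      refine ⟨(injective_iff_map_eq_zero _).2 fun x hx => ?_, fun x => ?_⟩
      · obtain ⟨y, rfl⟩ := cokernel_π_app_surjective _ Z x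
        rw [hd] at hx
        exact (cokernel_π_app_exact _ Z y).2 (((h Z).1 y).1 hx)
      · obtain ⟨y, rfl⟩ := (h Z).2 x
        exact ⟨_, hd Z y⟩
    have : IsIso d := NatIso.isIso_of_isIso_app d
    exact ⟨Arrow.mk f, ⟨(IsFinPresModule K).isoMk (@asIso _ _ _ _ d this)⟩⟩

variable (K) in
/-- The arrow category of the opposite category is the opposite of the arrow category. -/
def arrowOpEquiv : Arrow K ≌ (Arrow Kᵒᵖ)ᵒᵖ :=
  Comma.opEquiv (𝟭 K) (𝟭 K)

variable (K) in
/-- The contravariant counterpart of `presentedModule`: a morphism `f : X ⟶ Y` of `K` is sent to the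
finitely presented left module `Coker (K(Y, -) ⟶ K(X, -))`. -/
noncomputable def presentedLeftModule : Arrow K ⥤ (FinPresMod Kᵒᵖ)ᵒᵖ :=
  (arrowOpEquiv K).functor ⋙ (presentedModule Kᵒᵖ).op

instance : (presentedLeftModule K).Full := by
  unfold presentedLeftModule
  infer_instance
instance : (presentedLeftModule K).EssSurj := by
  unfold presentedLeftModule
  infer_instance

lemma presentedLeftModule_map_eq_iff {f g : Arrow K} (φ ψ : f ⟶ g) :
    (presentedLeftModule K).map φ = (presentedLeftModule K).map ψ ↔
      ∃ h : f.right ⟶ g.left, φ.left - ψ.left = f.hom ≫ h := by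
  have := presentedModule_map_eq_iff (K := Kᵒᵖ)
    ((arrowOpEquiv K).functor.map φ).unop
    ((arrowOpEquiv K).functor.map ψ).unop
  refine (Quiver.Hom.op_inj.eq_iff (a := (presentedModule Kᵒᵖ).map _)).trans (this.trans ?_)
  constructor
  · rintro ⟨h, e⟩
    exact ⟨h.unop, congrArg Quiver.Hom.unop e⟩
  · rintro ⟨h, e⟩
    exact ⟨h.op, congrArg Quiver.Hom.op e⟩

end Coker

/-! ### Ideal quotients of categories of morphisms -/

section IdealQuotient

variable {A : Type u} [Category.{v} A] [Preadditive A]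

/-- The projection `A ⥤ A/[P]`. -/
abbrev toIdealQuotient (P : ObjectProperty A) : A ⥤ IdealQuotient P :=
  CategoryTheory.Quotient.functor (idealRel P)

instance (P : ObjectProperty A) : (toIdealQuotient P).Additive where
  map_add := rfl

lemma toIdealQuotient_map_eq_iff (P : ObjectProperty A) {X Y : A} (f g : X ⟶ Y) :
    (toIdealQuotient P).map f = (toIdealQuotient P).map g ↔ f - g ∈ idealOf P X Y :=
  CategoryTheory.Quotient.functor_map_eq_iff _ f g

lemma toIdealQuotient_map_sub_eq_iff {P : ObjectProperty A} {X Y Z : A} (a b : X ⟶ Z)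
    (f : X ⟶ Y) (g : Y ⟶ Z) :
    (toIdealQuotient P).map a - (toIdealQuotient P).map b =
        (toIdealQuotient P).map f ≫ (toIdealQuotient P).map g ↔
      a - b - f ≫ g ∈ idealOf P X Z := by
  rw [← Functor.map_sub, ← Functor.map_comp, toIdealQuotient_map_eq_iff]

lemma comp_mem_idealOf_of_prop {P : ObjectProperty A} {X Y Z : A} (hZ : P Z) (f : X ⟶ Z)
    (g : Z ⟶ Y) : f ≫ g ∈ idealOf P X Y :=
  AddSubgroup.subset_closure ⟨Z, f, g, hZ, rfl⟩

/-- A full and essentially surjective functor `F` which identifies two parallel morphisms exactly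
when their difference lies in `[B]` exhibits its target as the ideal quotient by `[B]`. -/
lemma nonempty_idealQuotient_equivalence {U : Type*} [Category* U] (B : ObjectProperty A)
    (F : A ⥤ U) [F.Full] [F.EssSurj]
    (hF : ∀ {X Y : A} (f g : X ⟶ Y), F.map f = F.map g ↔ f - g ∈ idealOf B X Y) :
    Nonempty (IdealQuotient B ≌ U) := by
  have key : ∀ r : HomRel A, r = F.homRel → Nonempty (CategoryTheory.Quotient r ≌ U) := by
    rintro _ rfl
    exact ⟨(CategoryTheory.Quotient.lift F.homRel F fun _ _ _ _ h => h).asEquivalence⟩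
  refine key _ ?_
  funext X Y f g
  exact propext (hF f g).symm

/-- No closure of `P` under direct sums is needed: the morphisms which lift along `f` by a morphism
of `[P]` form a subgroup. -/
lemma exists_lift_of_mem_idealOf {P : ObjectProperty A} {X Y : A} (f : X ⟶ Y)
    (hf : ∀ Q, P Q → ∀ c : Q ⟶ Y, ∃ t : Q ⟶ X, t ≫ f = c) {Z : A} {c : Z ⟶ Y}
    (hc : c ∈ idealOf P Z Y) : ∃ t ∈ idealOf P Z X, t ≫ f = c := by
  induction hc using AddSubgroup.closure_induction with
  | mem x hx =>
    obtain ⟨Q, g, h, hQ, rfl⟩ := hx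
    obtain ⟨t, rfl⟩ := hf Q hQ h
    exact ⟨g ≫ t, comp_mem_idealOf_of_prop hQ _ _, by simp⟩
  | zero => exact ⟨0, zero_mem _, by simp⟩
  | add x y _ _ hx hy =>
    obtain ⟨s, hs, rfl⟩ := hx
    obtain ⟨t, ht, rfl⟩ := hy
    exact ⟨s + t, add_mem hs ht, by simp⟩
  | neg x _ hx =>
    obtain ⟨s, hs, rfl⟩ := hx
    exact ⟨-s, neg_mem hs, by simp⟩

lemma exists_extension_of_mem_idealOf {P : ObjectProperty A} {X Y : A} (f : X ⟶ Y)
    (hf : ∀ Q, P Q → ∀ c : X ⟶ Q, ∃ t : Y ⟶ Q, f ≫ t = c) {Z : A} {c : X ⟶ Z}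
    (hc : c ∈ idealOf P X Z) : ∃ t ∈ idealOf P Y Z, f ≫ t = c := by
  induction hc using AddSubgroup.closure_induction with
  | mem x hx =>
    obtain ⟨Q, g, h, hQ, rfl⟩ := hx
    obtain ⟨t, rfl⟩ := hf Q hQ g
    exact ⟨t ≫ h, comp_mem_idealOf_of_prop hQ _ _, by simp⟩
  | zero => exact ⟨0, zero_mem _, by simp⟩
  | add x y _ _ hx hy =>
    obtain ⟨s, hs, rfl⟩ := hx
    obtain ⟨t, ht, rfl⟩ := hy
    exact ⟨s + t, add_mem hs ht, by simp⟩
  | neg x _ hx =>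
    obtain ⟨s, hs, rfl⟩ := hx
    exact ⟨-s, neg_mem hs, by simp⟩

variable (W : ObjectProperty (Arrow A)) (P : ObjectProperty A)

/-- The functor from a full subcategory `W` of `Mor(A)` to `Mor(A/[P])`. -/
abbrev quotientArrow : W.FullSubcategory ⥤ Arrow (IdealQuotient P) :=
  W.ι ⋙ (toIdealQuotient P).mapArrow

/-- Every square of `A/[P]` between objects of `W` lifts to `A`, that is, each square of `A` which
commutes up to `[P]` can be changed by elements of `[P]` to a commutative one. -/
def LiftsSquares : Prop :=
  ∀ (f g : Arrow A), W f → W g → ∀ (a : f.left ⟶ g.left) (b : f.right ⟶ g.right),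
    a ≫ g.hom - f.hom ≫ b ∈ idealOf P f.left g.right →
    ∃ (a' : f.left ⟶ g.left) (b' : f.right ⟶ g.right),
      a' - a ∈ idealOf P f.left g.left ∧ b' - b ∈ idealOf P f.right g.right ∧
      a' ≫ g.hom = f.hom ≫ b'

variable {W P}

lemma LiftsSquares.full (h : LiftsSquares W P) : (quotientArrow W P).Full where
  map_surjective {f g} φ := by
    obtain ⟨a, ha⟩ := (toIdealQuotient P).map_surjective φ.left
    obtain ⟨b, hb⟩ := (toIdealQuotient P).map_surjective φ.right
    obtain ⟨a', b', ha', hb', e⟩ := h f.obj g.obj f.property g.property a b <| by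
      rw [← toIdealQuotient_map_eq_iff, Functor.map_comp, Functor.map_comp, ha, hb]
      exact φ.w
    refine ⟨W.homMk (Arrow.homMk a' b' e), ?_⟩
    ext
    · exact ((toIdealQuotient_map_eq_iff P _ _).2 ha').trans ha
    · exact ((toIdealQuotient_map_eq_iff P _ _).2 hb').trans hb

variable (W P) in
/-- Every morphism of `A` is isomorphic to an object of `W` after passing to `A/[P]`. -/
def IsDenseModulo : Prop :=
  ∀ ⦃X Y : A⦄ (g : X ⟶ Y), ∃ f : Arrow A, W f ∧
    Nonempty ((toIdealQuotient P).mapArrow.obj f ≅ (toIdealQuotient P).mapArrow.obj (Arrow.mk g))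

lemma IsDenseModulo.essSurj (h : IsDenseModulo W P) : (quotientArrow W P).EssSurj where
  mem_essImage g := by
    obtain ⟨g', hg'⟩ := (toIdealQuotient P).map_surjective g.hom
    obtain ⟨f, hf, ⟨e⟩⟩ := h g'
    refine ⟨⟨f, hf⟩, ⟨e ≪≫ eqToIso ?_⟩⟩
    exact congrArg Arrow.mk hg'

/-- The summands from `P` vanish in `A/[P]`. -/
noncomputable def idealQuotientBiprodIso [HasBinaryBiproducts A] (X : A) {Q : A} (hQ : P Q) :
    (toIdealQuotient P).obj (X ⊞ Q) ≅ (toIdealQuotient P).obj X where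
  hom := (toIdealQuotient P).map biprod.fst
  inv := (toIdealQuotient P).map biprod.inl
  hom_inv_id := by
    have h : biprod.fst ≫ biprod.inl - 𝟙 (X ⊞ Q) = -(biprod.snd ≫ biprod.inr) := by
      rw [← biprod.total]
      abel
    rw [← Functor.map_comp, ← CategoryTheory.Functor.map_id, toIdealQuotient_map_eq_iff, h]
    exact neg_mem (comp_mem_idealOf_of_prop hQ _ _)
  inv_hom_id := by
    rw [← Functor.map_comp, biprod.inl_fst, CategoryTheory.Functor.map_id]

/-- Adding to `g : X ⟶ Y` a summand `p : Q ⟶ Y` with `Q` in `P` does not change it in `A/[P]`. -/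
lemma nonempty_mapArrow_desc_iso [HasBinaryBiproducts A] {X Y Q : A} (hQ : P Q) (g : X ⟶ Y)
    (p : Q ⟶ Y) :
    Nonempty ((toIdealQuotient P).mapArrow.obj (Arrow.mk (biprod.desc g p)) ≅
      (toIdealQuotient P).mapArrow.obj (Arrow.mk g)) := by
  refine ⟨Iso.symm (Arrow.isoMk (idealQuotientBiprodIso X hQ).symm (Iso.refl _) ?_)⟩
  exact (((toIdealQuotient P).map_comp _ _).symm.trans
    (congrArg _ (biprod.inl_desc g p))).trans (Category.comp_id _).symm

lemma nonempty_mapArrow_lift_iso [HasBinaryBiproducts A] {X Y Q : A} (hQ : P Q) (g : X ⟶ Y)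
    (p : X ⟶ Q) :
    Nonempty ((toIdealQuotient P).mapArrow.obj (Arrow.mk (biprod.lift g p)) ≅
      (toIdealQuotient P).mapArrow.obj (Arrow.mk g)) := by
  refine ⟨Arrow.isoMk (Iso.refl _) (idealQuotientBiprodIso Y hQ) ?_⟩
  exact (Category.id_comp _).trans
    ((congrArg _ (biprod.lift_fst g p)).symm.trans ((toIdealQuotient P).map_comp _ _))

/-- The square `(f h, h g)` from `f` to `g` given by a diagonal `h`. -/
def diagonalSquare {f g : W.FullSubcategory} (h : f.obj.right ⟶ g.obj.left) : f ⟶ g :=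
  W.homMk (Arrow.homMk (f.obj.hom ≫ h) (h ≫ g.obj.hom) (by simp))

/-- The square of a diagonal factors through the identity morphism of the object
`g.obj.left`. -/
lemma diagonalSquare_mem {B : ObjectProperty W.FullSubcategory}
    (hB : ∀ X : A, ∃ hX : W (Arrow.mk (𝟙 X)), B ⟨Arrow.mk (𝟙 X), hX⟩)
    {f g : W.FullSubcategory} (h : f.obj.right ⟶ g.obj.left) :
    (diagonalSquare h : f ⟶ g) ∈ idealOf B f g := by
  obtain ⟨hX, hB⟩ := hB g.obj.left
  refine AddSubgroup.subset_closure ⟨⟨Arrow.mk (𝟙 g.obj.left), hX⟩,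
    W.homMk (Arrow.homMk (f.obj.hom ≫ h) h (by simp)),
    W.homMk (Arrow.homMk (𝟙 _) g.obj.hom (by simp)), hB, ?_⟩
  ext <;> simp [diagonalSquare]

/-- If the identity squares of the objects of `B` have on the right a diagonal up to `[P]`, then so
do all squares in `[B]`. -/
lemma exists_right_sub_mem_of_mem_idealOf {B : ObjectProperty W.FullSubcategory}
    (hB : ∀ z, B z → ∃ h : z.obj.right ⟶ z.obj.left,
      𝟙 _ - h ≫ z.obj.hom ∈ idealOf P z.obj.right z.obj.right)
    {f g : W.FullSubcategory} {φ : f ⟶ g} (hφ : φ ∈ idealOf B f g) :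
    ∃ h : f.obj.right ⟶ g.obj.left,
      φ.hom.right - h ≫ g.obj.hom ∈ idealOf P f.obj.right g.obj.right := by
  induction hφ using AddSubgroup.closure_induction with
  | mem x hx =>
    obtain ⟨z, α, β, hz, rfl⟩ := hx
    obtain ⟨h, hh⟩ := hB z hz
    refine ⟨α.hom.right ≫ h ≫ β.hom.left, ?_⟩
    have := comp_mem_idealOf P α.hom.right (mem_idealOf_comp P β.hom.right hh)
    simpa [Preadditive.comp_sub, Preadditive.sub_comp] using this
  | zero => exact ⟨0, by simp⟩
  | add x y _ _ hx hy =>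
    obtain ⟨s, hs⟩ := hx
    obtain ⟨t, ht⟩ := hy
    refine ⟨s + t, ?_⟩
    have := add_mem hs ht
    rwa [← add_sub_add_comm, ← Preadditive.add_comp] at this
  | neg x _ hx =>
    obtain ⟨s, hs⟩ := hx
    refine ⟨-s, ?_⟩
    have := neg_mem hs
    rwa [neg_sub', ← Preadditive.neg_comp] at this

lemma exists_left_sub_mem_of_mem_idealOf {B : ObjectProperty W.FullSubcategory}
    (hB : ∀ z, B z → ∃ h : z.obj.right ⟶ z.obj.left,
      𝟙 _ - z.obj.hom ≫ h ∈ idealOf P z.obj.left z.obj.left)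
    {f g : W.FullSubcategory} {φ : f ⟶ g} (hφ : φ ∈ idealOf B f g) :
    ∃ h : f.obj.right ⟶ g.obj.left,
      φ.hom.left - f.obj.hom ≫ h ∈ idealOf P f.obj.left g.obj.left := by
  induction hφ using AddSubgroup.closure_induction with
  | mem x hx =>
    obtain ⟨z, α, β, hz, rfl⟩ := hx
    obtain ⟨h, hh⟩ := hB z hz
    refine ⟨α.hom.right ≫ h ≫ β.hom.left, ?_⟩
    have := comp_mem_idealOf P α.hom.left (mem_idealOf_comp P β.hom.left hh)
    simpa [Preadditive.comp_sub, Preadditive.sub_comp] using this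
  | zero => exact ⟨0, by simp⟩
  | add x y _ _ hx hy =>
    obtain ⟨s, hs⟩ := hx
    obtain ⟨t, ht⟩ := hy
    refine ⟨s + t, ?_⟩
    have := add_mem hs ht
    rwa [← add_sub_add_comm, ← Preadditive.comp_add] at this
  | neg x _ hx =>
    obtain ⟨s, hs⟩ := hx
    refine ⟨-s, ?_⟩
    have := neg_mem hs
    rwa [neg_sub', ← Preadditive.comp_neg] at this

/-- Criterion for `W/[B] ≃ mod-(A/[P])`: modulo the squares `diagonalSquare h`, the kernel of the
functor consists of the squares whose right-hand side lies in `[P]`. -/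
lemma nonempty_equivalence_finPresMod {B : ObjectProperty W.FullSubcategory}
    (hsq : LiftsSquares W P) (hd : IsDenseModulo W P)
    (hid : ∀ X : A, ∃ hX : W (Arrow.mk (𝟙 X)), B ⟨Arrow.mk (𝟙 X), hX⟩)
    (hB : ∀ z, B z → ∃ h : z.obj.right ⟶ z.obj.left,
      𝟙 _ - h ≫ z.obj.hom ∈ idealOf P z.obj.right z.obj.right)
    (hker : ∀ {f g : W.FullSubcategory} (φ : f ⟶ g),
      φ.hom.right ∈ idealOf P f.obj.right g.obj.right → φ ∈ idealOf B f g) :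
    Nonempty (IdealQuotient B ≌ FinPresMod (IdealQuotient P)) := by
  have := hsq.full
  have := hd.essSurj
  refine nonempty_idealQuotient_equivalence B
    (quotientArrow W P ⋙ presentedModule (IdealQuotient P)) fun {f g} φ ψ => ?_
  refine (presentedModule_map_eq_iff ((quotientArrow W P).map φ)
    ((quotientArrow W P).map ψ)).trans ⟨fun ⟨h, e⟩ => ?_, fun hφ => ?_⟩
  · obtain ⟨h, rfl⟩ : ∃ h' : f.obj.right ⟶ g.obj.left, (toIdealQuotient P).map h' = h :=
      (toIdealQuotient P).map_surjective h
    have e' : (φ - ψ).hom.right - h ≫ g.obj.hom ∈ idealOf P f.obj.right g.obj.right :=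
      (toIdealQuotient_map_sub_eq_iff φ.hom.right ψ.hom.right h g.obj.hom).1 e
    rw [← sub_add_cancel (φ - ψ) (diagonalSquare (f := f) (g := g) h)]
    exact add_mem (hker _ e') (diagonalSquare_mem hid (f := f) (g := g) h)
  · obtain ⟨h, e⟩ := exists_right_sub_mem_of_mem_idealOf hB hφ
    exact ⟨(toIdealQuotient P).map h,
      (toIdealQuotient_map_sub_eq_iff φ.hom.right ψ.hom.right h g.obj.hom).2 e⟩

/-- Criterion for `W/[B] ≃ (mod-(A/[P])ᵒᵖ)ᵒᵖ`: modulo the squares `diagonalSquare h`, the kernel of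
the functor consists of the squares whose left-hand side lies in `[P]`. -/
lemma nonempty_equivalence_finPresMod_op {B : ObjectProperty W.FullSubcategory}
    (hsq : LiftsSquares W P) (hd : IsDenseModulo W P)
    (hid : ∀ X : A, ∃ hX : W (Arrow.mk (𝟙 X)), B ⟨Arrow.mk (𝟙 X), hX⟩)
    (hB : ∀ z, B z → ∃ h : z.obj.right ⟶ z.obj.left,
      𝟙 _ - z.obj.hom ≫ h ∈ idealOf P z.obj.left z.obj.left)
    (hker : ∀ {f g : W.FullSubcategory} (φ : f ⟶ g),
      φ.hom.left ∈ idealOf P f.obj.left g.obj.left → φ ∈ idealOf B f g) :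
    Nonempty (IdealQuotient B ≌ (FinPresMod (IdealQuotient P)ᵒᵖ)ᵒᵖ) := by
  have := hsq.full
  have := hd.essSurj
  refine nonempty_idealQuotient_equivalence B
    (quotientArrow W P ⋙ presentedLeftModule (IdealQuotient P)) fun {f g} φ ψ => ?_
  refine (presentedLeftModule_map_eq_iff ((quotientArrow W P).map φ)
    ((quotientArrow W P).map ψ)).trans ⟨fun ⟨h, e⟩ => ?_, fun hφ => ?_⟩
  · obtain ⟨h, rfl⟩ : ∃ h' : f.obj.right ⟶ g.obj.left, (toIdealQuotient P).map h' = h :=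
      (toIdealQuotient P).map_surjective h
    have e' : (φ - ψ).hom.left - f.obj.hom ≫ h ∈ idealOf P f.obj.left g.obj.left :=
      (toIdealQuotient_map_sub_eq_iff φ.hom.left ψ.hom.left f.obj.hom h).1 e
    rw [← sub_add_cancel (φ - ψ) (diagonalSquare (f := f) (g := g) h)]
    exact add_mem (hker _ e') (diagonalSquare_mem hid (f := f) (g := g) h)
  · obtain ⟨h, e⟩ := exists_left_sub_mem_of_mem_idealOf hB hφ
    exact ⟨(toIdealQuotient P).map h,
      (toIdealQuotient_map_sub_eq_iff φ.hom.left ψ.hom.left f.obj.hom h).2 e⟩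

end IdealQuotient

/-! ### Kernels for squares of deflations and of inflations -/

section Squares

variable {A : Type u} [Category.{v} A] [Preadditive A] {W : ObjectProperty (Arrow A)}
  {P : ObjectProperty A}

lemma liftsSquares_of_lifting
    (hW : ∀ f, W f → ∀ Q, P Q → ∀ c : Q ⟶ f.right, ∃ t : Q ⟶ f.left, t ≫ f.hom = c) :
    LiftsSquares W P := by
  intro f g _ hg a b hab
  obtain ⟨t, ht, e⟩ := exists_lift_of_mem_idealOf g.hom (hW g hg) hab
  refine ⟨a - t, b, ?_, ?_, ?_⟩
  · rw [sub_sub_cancel_left]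
    exact neg_mem ht
  · rw [sub_self]
    exact zero_mem _
  · rw [Preadditive.sub_comp, e, sub_sub_cancel]

lemma liftsSquares_of_extension
    (hW : ∀ f, W f → ∀ Q, P Q → ∀ c : f.left ⟶ Q, ∃ t : f.right ⟶ Q, f.hom ≫ t = c) :
    LiftsSquares W P := by
  intro f g hf _ a b hab
  obtain ⟨t, ht, e⟩ := exists_extension_of_mem_idealOf f.hom (hW f hf) hab
  refine ⟨a, b + t, ?_, ?_, ?_⟩
  · rw [sub_self]
    exact zero_mem _
  · rw [add_sub_cancel_left]
    exact ht
  · rw [Preadditive.comp_add, e, add_sub_cancel]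

variable {B : ObjectProperty W.FullSubcategory} {f g : W.FullSubcategory} (φ : f ⟶ g)

/-- After subtracting a square `(f h, h g)`, the square `φ` has zero right-hand side and factors
through `f.obj.left ⟶ 0`. -/
lemma mem_idealOf_of_right_mem_of_lifting
    (hW : ∀ f, W f → ∀ Q, P Q → ∀ c : Q ⟶ f.right, ∃ t : Q ⟶ f.left, t ≫ f.hom = c)
    (hid : ∀ X : A, ∃ hX : W (Arrow.mk (𝟙 X)), B ⟨Arrow.mk (𝟙 X), hX⟩)
    (hzero : ∀ X : A, ∃ (Z : A) (hX : W (Arrow.mk (0 : X ⟶ Z))), B ⟨Arrow.mk (0 : X ⟶ Z), hX⟩)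
    (hφ : φ.hom.right ∈ idealOf P f.obj.right g.obj.right) : φ ∈ idealOf B f g := by
  obtain ⟨t, -, e⟩ := exists_lift_of_mem_idealOf g.obj.hom (hW _ g.property) hφ
  obtain ⟨Z, hX, hZ⟩ := hzero f.obj.left
  rw [← sub_add_cancel φ (diagonalSquare (f := f) (g := g) t)]
  refine add_mem (AddSubgroup.subset_closure ⟨⟨Arrow.mk (0 : f.obj.left ⟶ Z), hX⟩,
    W.homMk (Arrow.homMk (𝟙 _) 0 (by simp)),
    W.homMk (Arrow.homMk (φ.hom.left - f.obj.hom ≫ t) 0 ?_), hZ, ?_⟩) (diagonalSquare_mem hid t)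
  · simp [Preadditive.sub_comp, e]
  · ext
    · exact Category.id_comp _
    · exact comp_zero.trans (sub_eq_zero.2 e.symm).symm

/-- After subtracting a square `(f h, h g)`, the square `φ` has zero left-hand side and factors
through `0 ⟶ g.obj.right`. -/
lemma mem_idealOf_of_left_mem_of_extension
    (hW : ∀ f, W f → ∀ Q, P Q → ∀ c : f.left ⟶ Q, ∃ t : f.right ⟶ Q, f.hom ≫ t = c)
    (hid : ∀ X : A, ∃ hX : W (Arrow.mk (𝟙 X)), B ⟨Arrow.mk (𝟙 X), hX⟩)
    (hzero : ∀ X : A, ∃ (Z : A) (hX : W (Arrow.mk (0 : Z ⟶ X))), B ⟨Arrow.mk (0 : Z ⟶ X), hX⟩)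
    (hφ : φ.hom.left ∈ idealOf P f.obj.left g.obj.left) : φ ∈ idealOf B f g := by
  obtain ⟨t, -, e⟩ := exists_extension_of_mem_idealOf f.obj.hom (hW _ f.property) hφ
  obtain ⟨Z, hX, hZ⟩ := hzero g.obj.right
  rw [← sub_add_cancel φ (diagonalSquare (f := f) (g := g) t)]
  refine add_mem (AddSubgroup.subset_closure ⟨⟨Arrow.mk (0 : Z ⟶ g.obj.right), hX⟩,
    W.homMk (Arrow.homMk 0 (φ.hom.right - t ≫ g.obj.hom) ?_),
    W.homMk (Arrow.homMk 0 (𝟙 _) (by simp)), hZ, ?_⟩) (diagonalSquare_mem hid t)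
  · simp [Preadditive.comp_sub, reassoc_of% e]
  · ext
    · exact comp_zero.trans (sub_eq_zero.2 e.symm).symm
    · exact Category.comp_id _

variable [HasBinaryBiproducts A]

/-- If the left-hand side of `φ` factors as `u ≫ v` through `Q`, and `p : Q' ⟶ g.obj.right` is a
morphism that lifts along `g` for which `Q ⊞ Q' ⟶ g.obj.right` lies in `B`, then `φ` factors through
the latter. -/
lemma mem_idealOf_of_left_eq_comp {Q Q' : A} (u : f.obj.left ⟶ Q) (v : Q ⟶ g.obj.left)
    (huv : u ≫ v = φ.hom.left) (q : Q' ⟶ g.obj.left) (p : Q' ⟶ g.obj.right)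
    (hq : q ≫ g.obj.hom = p) (hz : W (Arrow.mk (biprod.desc (v ≫ g.obj.hom) p)))
    (hB : B ⟨_, hz⟩) : φ ∈ idealOf B f g := by
  refine AddSubgroup.subset_closure ⟨⟨_, hz⟩,
    W.homMk (Arrow.homMk (biprod.lift u 0) φ.hom.right ?_),
    W.homMk (Arrow.homMk (biprod.desc v q) (𝟙 _) ?_), hB, ?_⟩
  · simp [reassoc_of% huv]
  · exact biprod.hom_ext' _ _ (by simp) (by simp [hq])
  · ext <;> simp [huv]

/-- If the right-hand side of `φ` factors as `u ≫ v` through `Q`, and `i : f.obj.left ⟶ Q'` is a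
morphism that extends along `f` for which `f.obj.left ⟶ Q ⊞ Q'` lies in `B`, then `φ` factors
through the latter. -/
lemma mem_idealOf_of_right_eq_comp {Q Q' : A} (u : f.obj.right ⟶ Q) (v : Q ⟶ g.obj.right)
    (huv : u ≫ v = φ.hom.right) (q : f.obj.right ⟶ Q') (i : f.obj.left ⟶ Q')
    (hq : f.obj.hom ≫ q = i) (hz : W (Arrow.mk (biprod.lift (f.obj.hom ≫ u) i)))
    (hB : B ⟨_, hz⟩) : φ ∈ idealOf B f g := by
  refine AddSubgroup.subset_closure ⟨⟨_, hz⟩,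
    W.homMk (Arrow.homMk (𝟙 _) (biprod.lift u q) ?_),
    W.homMk (Arrow.homMk φ.hom.left (biprod.desc v 0) ?_), hB, ?_⟩
  · exact biprod.hom_ext _ _ (by simp) (by simp [hq])
  · simp [huv]
  · ext <;> simp [huv]

end Squares

/-- For `e : f ≅ 1 ⊕ p` with `p : P ⟶ Y`, the morphism `f` is split by a morphism `h` up to
morphisms which factor through `P` on the source, and through `Y` on the target. -/
lemma exists_split_of_iso_map {C : Type u} [Category.{v} C] [Preadditive C]
    [HasBinaryBiproducts C] {X P Y Z₁ Z₂ : C} {f : Z₁ ⟶ Z₂} {p : P ⟶ Y}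
    (e : Arrow.mk f ≅ Arrow.mk (biprod.map (𝟙 X) p)) :
    ∃ h : Z₂ ⟶ Z₁, (∃ (u : Z₁ ⟶ P) (v : P ⟶ Z₁), 𝟙 Z₁ - f ≫ h = u ≫ v) ∧
      ∃ (u : Z₂ ⟶ Y) (v : Y ⟶ Z₂), 𝟙 Z₂ - h ≫ f = u ≫ v := by
  let a : Z₁ ≅ X ⊞ P := Arrow.leftFunc.mapIso e
  let b : Z₂ ≅ X ⊞ Y := Arrow.rightFunc.mapIso e
  have hf : f = a.hom ≫ biprod.map (𝟙 X) p ≫ b.inv := by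
    rw [← Category.assoc, Iso.eq_comp_inv]
    exact (Arrow.w e.hom).symm
  refine ⟨b.hom ≫ biprod.fst ≫ biprod.inl ≫ a.inv,
    ⟨a.hom ≫ biprod.snd, biprod.inr ≫ a.inv, ?_⟩, ⟨b.hom ≫ biprod.snd, biprod.inr ≫ b.inv, ?_⟩⟩
  · rw [sub_eq_iff_eq_add', ← cancel_epi a.inv, ← cancel_mono a.hom]
    simp [hf]
  · rw [sub_eq_iff_eq_add', ← cancel_epi b.inv, ← cancel_mono b.hom]
    simp [hf]

/-! ### Deflations and inflations in extriangulated categories -/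

namespace ExtriangulatedStructure

variable {C : Type u} [Category.{v} C] [Preadditive C] [HasZeroObject C] [HasBinaryBiproducts C]
  (S : ExtriangulatedStructure.{w} C)

variable {S} in
lemma IsDeflation.iso_comp {B B' C₀ : C} {y : B ⟶ C₀} (hy : S.IsDeflation y) (e : B' ≅ B) :
    S.IsDeflation (e.hom ≫ y) := by
  obtain ⟨A, x, δ, h⟩ := hy
  exact ⟨A, x ≫ e.inv, δ, h.trans (Quotient.sound ⟨e.symm, rfl, by simp⟩)⟩

variable {S} in
lemma IsInflation.comp_iso {A B B' : C} {x : A ⟶ B} (hx : S.IsInflation x) (e : B ≅ B') :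
    S.IsInflation (x ≫ e.hom) := by
  obtain ⟨C₀, y, δ, h⟩ := hx
  exact ⟨C₀, e.inv ≫ y, δ, h.trans (Quotient.sound ⟨e, rfl, by simp⟩)⟩

lemma isDeflation_snd (A C₀ : C) : S.IsDeflation (biprod.snd : A ⊞ C₀ ⟶ C₀) :=
  ⟨A, biprod.inl, 0, S.s_zero A C₀⟩

lemma isInflation_inl (A C₀ : C) : S.IsInflation (biprod.inl : A ⟶ A ⊞ C₀) :=
  ⟨C₀, biprod.snd, 0, S.s_zero A C₀⟩

lemma isDeflation_id (X : C) : S.IsDeflation (𝟙 X) := by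
  simpa using (S.isDeflation_snd 0 X).iso_comp (isoZeroBiprod (isZero_zero C))

lemma isInflation_id (X : C) : S.IsInflation (𝟙 X) := by
  simpa using (S.isInflation_inl X 0).comp_iso (isoBiprodZero (isZero_zero C)).symm

lemma isDeflation_of_isZero {X Z : C} (hZ : IsZero Z) (f : X ⟶ Z) : S.IsDeflation f := by
  rw [hZ.eq_of_tgt f ((isoBiprodZero hZ).hom ≫ biprod.snd)]
  exact (S.isDeflation_snd X Z).iso_comp _

lemma isInflation_of_isZero {Z X : C} (hZ : IsZero Z) (f : Z ⟶ X) : S.IsInflation f := by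
  rw [hZ.eq_of_src f (biprod.inl ≫ (isoZeroBiprod hZ).symm.hom)]
  exact (S.isInflation_inl Z X).comp_iso _

variable {S} in
lemma IsDeflation.comp {A B C₀ : C} {f : A ⟶ B} {g : B ⟶ C₀} (hf : S.IsDeflation f)
    (hg : S.IsDeflation g) : S.IsDeflation (f ≫ g) := by
  obtain ⟨D, f', δ, h⟩ := hf
  obtain ⟨F, g', δ', h'⟩ := hg
  obtain ⟨E₀, d, e, i, k, δ'', -, -, rfl, -, h'', -⟩ := S.et4_op f' f g' g δ δ' h h'
  exact ⟨E₀, i, δ'', h''⟩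

variable {S} in
lemma IsInflation.comp {A B C₀ : C} {f : A ⟶ B} {g : B ⟶ C₀} (hf : S.IsInflation f)
    (hg : S.IsInflation g) : S.IsInflation (f ≫ g) := by
  obtain ⟨D, f', δ, h⟩ := hf
  obtain ⟨F, g', δ', h'⟩ := hg
  obtain ⟨E₀, i, k, d, e, δ'', rfl, -, -, h'', -⟩ := S.et4 f f' g g' δ δ' h h'
  exact ⟨E₀, k, δ'', h''⟩

variable {S} in
lemma IsDeflation.map {B C₀ B' C₀' : C} {y : B ⟶ C₀} {y' : B' ⟶ C₀'} (hy : S.IsDeflation y)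
    (hy' : S.IsDeflation y') : S.IsDeflation (biprod.map y y') := by
  obtain ⟨A, x, δ, h⟩ := hy
  obtain ⟨A', x', δ', h'⟩ := hy'
  exact ⟨_, _, _, S.s_sum δ δ' x y x' y' h h'⟩

variable {S} in
lemma IsInflation.map {A B A' B' : C} {x : A ⟶ B} {x' : A' ⟶ B'} (hx : S.IsInflation x)
    (hx' : S.IsInflation x') : S.IsInflation (biprod.map x x') := by
  obtain ⟨C₀, y, δ, h⟩ := hx
  obtain ⟨C₀', y', δ', h'⟩ := hx'
  exact ⟨_, _, _, S.s_sum δ δ' x y x' y' h h'⟩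

variable {S} in
/-- The morphism `(g, p)` is the composite of `1 ⊕ p` and of `(g, 1)`, and the latter is isomorphic
to a projection. -/
lemma IsDeflation.desc {X Q Y : C} {p : Q ⟶ Y} (hp : S.IsDeflation p) (g : X ⟶ Y) :
    S.IsDeflation (biprod.desc g p) := by
  -- The shear `(x, y) ↦ (x, g x + y)`.
  let e : X ⊞ Y ≅ X ⊞ Y :=
    { hom := biprod.lift biprod.fst (biprod.desc g (𝟙 Y))
      inv := biprod.lift biprod.fst (biprod.desc (-g) (𝟙 Y)) }
  have h : biprod.desc g p = biprod.map (𝟙 X) p ≫ e.hom ≫ biprod.snd := by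
    ext <;> simp [e]
  rw [h]
  exact ((S.isDeflation_id X).map hp).comp ((S.isDeflation_snd X Y).iso_comp e)

variable {S} in
/-- The morphism `(g, i)` is the composite of `(g, 1)`, which is isomorphic to the inclusion of a
summand, and of `1 ⊕ i`. -/
lemma IsInflation.lift {X Y Q : C} {i : X ⟶ Q} (hi : S.IsInflation i) (g : X ⟶ Y) :
    S.IsInflation (biprod.lift g i) := by
  -- The shear `(x, y) ↦ (g x + y, x)`.
  let e : X ⊞ Y ≅ Y ⊞ X :=
    { hom := biprod.desc (biprod.lift g (𝟙 X)) biprod.inl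
      inv := biprod.desc biprod.inr (biprod.lift (𝟙 X) (-g)) }
  have h : biprod.lift g i = (biprod.inl ≫ e.hom) ≫ biprod.map (𝟙 Y) i := by
    ext <;> simp [e]
  rw [h]
  exact ((S.isInflation_inl X Y).comp_iso e).comp ((S.isInflation_id Y).map hi)

lemma projectives_of_isZero {Z : C} (hZ : IsZero Z) : S.projectives Z :=
  fun _ _ _ _ _ => ⟨0, hZ.eq_of_src _ _⟩

lemma injectives_of_isZero {Z : C} (hZ : IsZero Z) : S.injectives Z :=
  fun _ _ _ _ _ => ⟨0, hZ.eq_of_tgt _ _⟩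

/-! ### The four equivalences -/

variable (M : ObjectProperty C)

section

variable [HasBinaryBiproducts M.FullSubcategory]

variable {M} in
/-- Biproducts formed in `M` are biproducts in the ambient category. -/
@[simps]
noncomputable def biprodIso (X Y : M.FullSubcategory) : (X ⊞ Y).obj ≅ X.obj ⊞ Y.obj where
  hom := biprod.lift (biprod.fst : X ⊞ Y ⟶ X).hom (biprod.snd : X ⊞ Y ⟶ Y).hom
  inv := biprod.desc (biprod.inl : X ⟶ X ⊞ Y).hom (biprod.inr : Y ⟶ X ⊞ Y).hom
  hom_inv_id := by
    rw [biprod.lift_desc]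
    exact congrArg InducedCategory.Hom.hom (biprod.total (X := X) (Y := Y))
  inv_hom_id := by
    ext <;> simp [← ObjectProperty.FullSubcategory.comp_hom]

variable {S M}

lemma projectives_biprod {X Y : M.FullSubcategory} (hX : S.projectives X.obj)
    (hY : S.projectives Y.obj) : S.projectives (X ⊞ Y).obj := by
  intro B C₀ y hy c
  obtain ⟨a, ha⟩ := hX y hy ((biprod.inl : X ⟶ X ⊞ Y).hom ≫ c)
  obtain ⟨b, hb⟩ := hY y hy ((biprod.inr : Y ⟶ X ⊞ Y).hom ≫ c)
  refine ⟨(biprodIso X Y).hom ≫ biprod.desc a b, ?_⟩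
  rw [Category.assoc, ← Iso.eq_inv_comp]
  ext <;> simp [ha, hb]

lemma injectives_biprod {X Y : M.FullSubcategory} (hX : S.injectives X.obj)
    (hY : S.injectives Y.obj) : S.injectives (X ⊞ Y).obj := by
  intro A B x hx c
  obtain ⟨a, ha⟩ := hX x hx (c ≫ (biprod.fst : X ⊞ Y ⟶ X).hom)
  obtain ⟨b, hb⟩ := hY x hx (c ≫ (biprod.snd : X ⊞ Y ⟶ Y).hom)
  refine ⟨biprod.lift a b ≫ (biprodIso X Y).inv, ?_⟩
  rw [← Category.assoc, Iso.comp_inv_eq]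
  ext <;> simp [ha, hb]

/-- The biproduct `X ⊞ Q` is here the one formed in `M`. -/
lemma deflations_desc {X Q Y : M.FullSubcategory} {p : Q ⟶ Y} (hp : S.IsDeflation p.hom)
    (g : X ⟶ Y) : S.deflations M (Arrow.mk (biprod.desc g p)) := by
  have h : (biprod.desc g p).hom = (biprodIso X Q).hom ≫ biprod.desc g.hom p.hom := by
    rw [← Iso.inv_comp_eq]
    ext <;> simp [← ObjectProperty.FullSubcategory.comp_hom]
  change S.IsDeflation (biprod.desc g p).hom
  rw [h]
  exact (hp.desc g.hom).iso_comp _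

/-- The biproduct `Y ⊞ Q` is here the one formed in `M`. -/
lemma inflations_lift {X Y Q : M.FullSubcategory} {i : X ⟶ Q} (hi : S.IsInflation i.hom)
    (g : X ⟶ Y) : S.inflations M (Arrow.mk (biprod.lift g i)) := by
  have h : (biprod.lift g i).hom = biprod.lift g.hom i.hom ≫ (biprodIso Y Q).inv := by
    rw [Iso.eq_comp_inv]
    ext <;> simp [← ObjectProperty.FullSubcategory.comp_hom]
  change S.IsInflation (biprod.lift g i).hom
  rw [h]
  exact (hi.lift g.hom).comp_iso (biprodIso Y Q).symm

end

variable {M}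

lemma deflations_lifting (f : Arrow M.FullSubcategory) (hf : S.deflations M f)
    (Q : M.FullSubcategory) (hQ : S.projectives.inverseImage M.ι Q) (c : Q ⟶ f.right) :
    ∃ t : Q ⟶ f.left, t ≫ f.hom = c := by
  obtain ⟨t, ht⟩ := hQ f.hom.hom hf c.hom
  exact ⟨M.homMk t, by ext; exact ht⟩

lemma inflations_extension (f : Arrow M.FullSubcategory) (hf : S.inflations M f)
    (Q : M.FullSubcategory) (hQ : S.injectives.inverseImage M.ι Q) (c : f.left ⟶ Q) :
    ∃ t : f.right ⟶ Q, f.hom ≫ t = c := by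
  obtain ⟨t, ht⟩ := hQ f.hom.hom hf c.hom
  exact ⟨M.homMk t, by ext; exact ht⟩

variable {S}

lemma HasEnoughProjectives.exists_deflation (hS : S.HasEnoughProjectives)
    (hM : S.projectives ≤ M) (Y : M.FullSubcategory) :
    ∃ (Q : M.FullSubcategory) (p : Q ⟶ Y), S.projectives Q.obj ∧ S.IsDeflation p.hom := by
  obtain ⟨Q, p, hQ, hp⟩ := hS Y.obj
  exact ⟨⟨Q, hM _ hQ⟩, M.homMk p, hQ, hp⟩

lemma HasEnoughInjectives.exists_inflation (hS : S.HasEnoughInjectives)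
    (hM : S.injectives ≤ M) (X : M.FullSubcategory) :
    ∃ (Q : M.FullSubcategory) (i : X ⟶ Q), S.injectives Q.obj ∧ S.IsInflation i.hom := by
  obtain ⟨Q, i, hQ, hi⟩ := hS X.obj
  exact ⟨⟨Q, hM _ hQ⟩, M.homMk i, hQ, hi⟩

/-- Identity morphisms have the form `1 ⊕ (0 ⟶ 0)`. -/
lemma nonempty_iso_map_id_zero (X : C) :
    Nonempty (Arrow.mk (𝟙 X) ≅ Arrow.mk (biprod.map (𝟙 X) (0 : (0 : C) ⟶ 0))) :=
  ⟨Arrow.isoMk (isoBiprodZero (isZero_zero C)) (isoBiprodZero (isZero_zero C))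
    (biprod.hom_ext _ _ (by simp) (by simp))⟩

lemma nonempty_iso_map_zero {X Y : C} (f : X ⟶ Y) :
    Nonempty (Arrow.mk f ≅ Arrow.mk (biprod.map (𝟙 (0 : C)) f)) :=
  ⟨Arrow.isoMk (isoZeroBiprod (isZero_zero C)) (isoZeroBiprod (isZero_zero C))
    (biprod.hom_ext _ _ (by simp) (by simp))⟩

variable [HasBinaryBiproducts M.FullSubcategory]

lemma isDenseModulo_deflations (hS : S.HasEnoughProjectives) (hM : S.projectives ≤ M) :
    IsDenseModulo (S.deflations M) (S.projectives.inverseImage M.ι) := by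
  intro X Y g
  obtain ⟨Q, p, hQ, hp⟩ := hS.exists_deflation hM Y
  exact ⟨_, deflations_desc hp g,
    nonempty_mapArrow_desc_iso (P := S.projectives.inverseImage M.ι) hQ g p⟩

lemma isDenseModulo_inflations (hS : S.HasEnoughInjectives) (hM : S.injectives ≤ M) :
    IsDenseModulo (S.inflations M) (S.injectives.inverseImage M.ι) := by
  intro X Y g
  obtain ⟨Q, p, hQ, hp⟩ := hS.exists_inflation hM X
  exact ⟨_, inflations_lift hp g,
    nonempty_mapArrow_lift_iso (P := S.injectives.inverseImage M.ι) hQ g p⟩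

/-- The objects of `s-epi(M)` through which squares get factored are identities and `X ⟶ 0`. -/
lemma nonempty_sEpi_equivalence (hS : S.HasEnoughProjectives) (hM : S.projectives ≤ M) :
    Nonempty (IdealQuotient (S.sEpi M) ≌ FinPresMod (S.ModProjectives M)) := by
  have hid (X : M.FullSubcategory) : ∃ hX : S.deflations M (Arrow.mk (𝟙 X)),
      S.sEpi M ⟨Arrow.mk (𝟙 X), hX⟩ :=
    ⟨S.isDeflation_id X.obj, inferInstanceAs (IsSplitEpi (𝟙 X))⟩
  refine nonempty_equivalence_finPresMod
    (liftsSquares_of_lifting fun f => S.deflations_lifting f)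
    (isDenseModulo_deflations hS hM) hid (fun z hz => ?_) fun φ hφ =>
      mem_idealOf_of_right_mem_of_lifting φ (fun f => S.deflations_lifting f) hid (fun X => ?_) hφ
  · obtain ⟨⟨s, hs⟩⟩ := hz
    exact ⟨s, by simp [hs]⟩
  · let Z : M.FullSubcategory := ⟨0, hM _ (S.projectives_of_isZero (isZero_zero C))⟩
    exact ⟨Z, S.isDeflation_of_isZero (isZero_zero C) (0 : X ⟶ Z).hom,
      ⟨⟨⟨0, InducedCategory.hom_ext ((isZero_zero C).eq_of_tgt _ _)⟩⟩⟩⟩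

/-- The objects of `s-mono(M)` through which squares get factored are identities and `0 ⟶ X`. -/
lemma nonempty_sMono_equivalence (hS : S.HasEnoughInjectives) (hM : S.injectives ≤ M) :
    Nonempty (IdealQuotient (S.sMono M) ≌ (FinPresMod (S.ModInjectives M)ᵒᵖ)ᵒᵖ) := by
  have hid (X : M.FullSubcategory) : ∃ hX : S.inflations M (Arrow.mk (𝟙 X)),
      S.sMono M ⟨Arrow.mk (𝟙 X), hX⟩ :=
    ⟨S.isInflation_id X.obj, inferInstanceAs (IsSplitMono (𝟙 X))⟩
  refine nonempty_equivalence_finPresMod_op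
    (liftsSquares_of_extension fun f => S.inflations_extension f)
    (isDenseModulo_inflations hS hM) hid (fun z hz => ?_) fun φ hφ =>
      mem_idealOf_of_left_mem_of_extension φ (fun f => S.inflations_extension f) hid
        (fun X => ?_) hφ
  · obtain ⟨⟨s, hs⟩⟩ := hz
    exact ⟨s, by simp [hs]⟩
  · let Z : M.FullSubcategory := ⟨0, hM _ (S.injectives_of_isZero (isZero_zero C))⟩
    exact ⟨Z, S.isInflation_of_isZero (isZero_zero C) (0 : Z ⟶ X).hom,
      ⟨⟨⟨0, InducedCategory.hom_ext ((isZero_zero C).eq_of_src _ _)⟩⟩⟩⟩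

/-- The ideal `[𝒫]` of `M` consists of the morphisms that factor through a single projective, since
`𝒫` is closed under finite direct sums. -/
lemma exists_factorization_of_mem_idealOf_projectives (hM : S.projectives ≤ M)
    {X Y : M.FullSubcategory} {f : X ⟶ Y}
    (hf : f ∈ idealOf (S.projectives.inverseImage M.ι) X Y) :
    ∃ (Q : M.FullSubcategory) (u : X ⟶ Q) (v : Q ⟶ Y), S.projectives Q.obj ∧ u ≫ v = f :=
  (mem_idealOf_iff (S.projectives.inverseImage M.ι)
    ⟨⟨0, hM _ (S.projectives_of_isZero (isZero_zero C))⟩, S.projectives_of_isZero (isZero_zero C)⟩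
    (fun Z W hZ hW => ⟨BinaryBiproduct.bicone Z W, projectives_biprod hZ hW⟩) f).1 hf

lemma exists_factorization_of_mem_idealOf_injectives (hM : S.injectives ≤ M)
    {X Y : M.FullSubcategory} {f : X ⟶ Y}
    (hf : f ∈ idealOf (S.injectives.inverseImage M.ι) X Y) :
    ∃ (Q : M.FullSubcategory) (u : X ⟶ Q) (v : Q ⟶ Y), S.injectives Q.obj ∧ u ≫ v = f :=
  (mem_idealOf_iff (S.injectives.inverseImage M.ι)
    ⟨⟨0, hM _ (S.injectives_of_isZero (isZero_zero C))⟩, S.injectives_of_isZero (isZero_zero C)⟩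
    (fun Z W hZ hW => ⟨BinaryBiproduct.bicone Z W, injectives_biprod hZ hW⟩) f).1 hf

/-- The objects of `sp-epi(M)` through which squares get factored are identities and deflations with
projective source. -/
lemma nonempty_spEpi_equivalence (hS : S.HasEnoughProjectives) (hM : S.projectives ≤ M) :
    Nonempty (IdealQuotient (S.spEpi M) ≌ (FinPresMod (S.ModProjectives M)ᵒᵖ)ᵒᵖ) := by
  have h0 := S.projectives_of_isZero (isZero_zero C)
  refine nonempty_equivalence_finPresMod_op
    (liftsSquares_of_lifting fun f => S.deflations_lifting f)
    (isDenseModulo_deflations hS hM)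
    (fun X => ⟨S.isDeflation_id X.obj,
      X.obj, 0, 0, 0, X.property, h0, hM _ h0, nonempty_iso_map_id_zero X.obj⟩)
    (fun z ⟨X, P, Y, p, hX, hP, hY, ⟨e⟩⟩ => ?_) fun {f g} φ hφ => ?_
  -- An object `1 ⊕ (P ⟶ Y)` becomes a split monomorphism in `M/[𝒫]`.
  · obtain ⟨h, ⟨u, v, huv⟩, -⟩ := exists_split_of_iso_map e
    refine ⟨M.homMk h, AddSubgroup.subset_closure
      ⟨⟨P, hM _ hP⟩, M.homMk u, M.homMk v, hP, ?_⟩⟩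
    ext
    exact huv.symm
  · obtain ⟨Q, u, v, hQ, huv⟩ := exists_factorization_of_mem_idealOf_projectives hM hφ
    obtain ⟨Q', p, hQ', hp⟩ := hS.exists_deflation hM g.obj.right
    obtain ⟨q, hq⟩ := S.deflations_lifting g.obj g.property Q' hQ' p
    exact mem_idealOf_of_left_eq_comp φ u v huv q p hq (deflations_desc hp _)
      ⟨0, _, _, _, hM _ h0, projectives_biprod hQ hQ', g.obj.right.property,
        nonempty_iso_map_zero _⟩

/-- The objects of `si-mono(M)` through which squares get factored are identities and inflations
with injective target. -/
lemma nonempty_siMono_equivalence (hS : S.HasEnoughInjectives) (hM : S.injectives ≤ M) :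
    Nonempty (IdealQuotient (S.siMono M) ≌ FinPresMod (S.ModInjectives M)) := by
  have h0 := S.injectives_of_isZero (isZero_zero C)
  refine nonempty_equivalence_finPresMod
    (liftsSquares_of_extension fun f => S.inflations_extension f)
    (isDenseModulo_inflations hS hM)
    (fun X => ⟨S.isInflation_id X.obj,
      X.obj, 0, 0, 0, X.property, hM _ h0, h0, nonempty_iso_map_id_zero X.obj⟩)
    (fun z ⟨X, Y, I, j, hX, hY, hI, ⟨e⟩⟩ => ?_) fun {f g} φ hφ => ?_
  -- An object `1 ⊕ (Y ⟶ I)` becomes a split epimorphism in `M/[ℐ]`.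
  · obtain ⟨h, -, u, v, huv⟩ := exists_split_of_iso_map e
    refine ⟨M.homMk h, AddSubgroup.subset_closure
      ⟨⟨I, hM _ hI⟩, M.homMk u, M.homMk v, hI, ?_⟩⟩
    ext
    exact huv.symm
  · obtain ⟨Q, u, v, hQ, huv⟩ := exists_factorization_of_mem_idealOf_injectives hM hφ
    obtain ⟨Q', i, hQ', hi⟩ := hS.exists_inflation hM f.obj.left
    obtain ⟨q, hq⟩ := S.inflations_extension f.obj f.property Q' hQ' i
    exact mem_idealOf_of_right_eq_comp φ u v huv q i hq (inflations_lift hi _)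
      ⟨0, _, _, _, hM _ h0, f.obj.left.property, injectives_biprod hQ hQ',
        nonempty_iso_map_zero _⟩

end ExtriangulatedStructure

end Extri

theorem mainTheorem1 {C : Type u} [Category.{v} C] [Preadditive C] [HasZeroObject C]
    [HasBinaryBiproducts C]
    (S : Extri.ExtriangulatedStructure.{w} C)
    (M : ObjectProperty C) (hM : HasBinaryBiproducts M.FullSubcategory) :
    (S.HasEnoughProjectives → S.projectives ≤ M →
      Nonempty (Extri.IdealQuotient (S.sEpi M) ≌ Extri.FinPresMod (S.ModProjectives M)) ∧
      Nonempty (Extri.IdealQuotient (S.spEpi M) ≌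
        (Extri.FinPresMod (S.ModProjectives M)ᵒᵖ)ᵒᵖ)) ∧
    (S.HasEnoughInjectives → S.injectives ≤ M →
      Nonempty (Extri.IdealQuotient (S.sMono M) ≌
        (Extri.FinPresMod (S.ModInjectives M)ᵒᵖ)ᵒᵖ) ∧
      Nonempty (Extri.IdealQuotient (S.siMono M) ≌ Extri.FinPresMod (S.ModInjectives M))) :=
  ⟨fun hS hP => ⟨Extri.ExtriangulatedStructure.nonempty_sEpi_equivalence hS hP,
      Extri.ExtriangulatedStructure.nonempty_spEpi_equivalence hS hP⟩,
    fun hS hI => ⟨Extri.ExtriangulatedStructure.nonempty_sMono_equivalence hS hI,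
      Extri.ExtriangulatedStructure.nonempty_siMono_equivalence hS hI⟩⟩
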